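/- Let $R$ be an associative ring with unit. For a set $\mathcal G$ of right $R$-modules, a $\mathcal G$-filtration of a right $R$-module $M$ is a chain of submodules $(G_\alpha : \alpha<\kappa)$ of $M$, indexed by the ordinals below some cardinal $\kappa$, with $G_\alpha \subseteq G_\beta$ for $\alpha\le\beta<\kappa$, $G_0=0$, $G_\alpha=\bigcup_{\beta<\alpha}G_\beta$ for every limit ordinal $\alpha<\kappa$, $M=\bigcup_{\alpha<\kappa}G_\alpha$, and $G_{\alpha+1}/G_\alpha$ isomorphic to a module in $\mathcal G$ whenever $\alpha+1<\kappa$. (The cardinal $\kappa$ may be finite; the empty union is understood to be $0$.) Let $\operatorname{Filt-}\mathcal G$ be the class of all right $R$-modules that have a $\mathcal G$-filtration. A class $\mathcal X$ of right $R$-modules is deconstructible if $\mathcal X=\operatorname{Filt-}\mathcal G$ for some set $\mathcal G$ of right $R$-modules. An $\mathcal X$-precover of a right $R$-module $M$ is a homomorphism $f:X\to M$ with $X\in\mathcal X$ such that $\operatorname{Hom}_R(X',X)\to\operatorname{Hom}_R(X',M)$, $h\mapsto fh$, is surjective for every $X'\in\mathcal X$. A special $\mathcal X$-precover of $M$ is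 a homomorphism $f:X\to M$ with $X\in\mathcal X$ such that $\operatorname{Im} f=\sum_{X'\in\mathcal X,\ g\in\operatorname{Hom}_R(X',M)}\operatorname{Im} g$ and $\operatorname{Ext}^1_R(X',\operatorname{Ker} f)=0$ for every $X'\in\mathcal X$ ($f$ need not be surjective). Theorem. Let $\mathcal X$ be a deconstructible class of right $R$-modules. Then $\mathcal X$ is precovering, that is, every right $R$-module has an $\mathcal X$-precover; moreover, $\mathcal X$ is special precovering, that is, every right $R$-module has a special $\mathcal X$-precover. -/

import Mathlib

open CategoryTheory

universe u

/-- The category of right `R`-modules: modules over the opposite ring. -/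
abbrev RightMod (R : Type u) [Ring R] : Type (u + 1) := ModuleCat.{u} Rᵐᵒᵖ

namespace RightMod

variable {R : Type u} [Ring R]

/-- `F` is a `𝒢`-filtration of `M` indexed by the ordinals below the cardinal `κ`: a continuous
chain of submodules `(F α : α < κ)` with `F 0 = 0`, with union `M`, and with all consecutive factors
`F (α + 1) / F α` isomorphic to a module in the set `𝒢 = {G i : i ∈ ι}`. Only the values `F α` with
`α < κ` matter. If `κ` is infinite, then `α + 1 < κ` is the same as `α < κ`; if `κ = n + 1` is
finite, this is a finite chain `F 0 ≤ ⋯ ≤ F n = M`. -/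
structure IsFiltration {ι : Type u} (G : ι → RightMod R) (M : RightMod R)
    (κ : Cardinal.{u}) (F : Ordinal.{u} → Submodule Rᵐᵒᵖ M) : Prop where
  zero : F 0 = ⊥
  mono : ∀ α β : Ordinal.{u}, α ≤ β → β < κ.ord → F α ≤ F β
  continuous : ∀ α : Ordinal.{u}, α < κ.ord → Order.IsSuccLimit α → F α = ⨆ β < α, F β
  union : ⨆ α < κ.ord, F α = ⊤
  factor : ∀ α : Ordinal.{u}, α + 1 < κ.ord →
    ∃ i : ι, Nonempty ((F (α + 1) ⧸ (F α).submoduleOf (F (α + 1))) ≃ₗ[Rᵐᵒᵖ] G i)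

/-- The class `Filt-𝒢` of all `𝒢`-filtered modules, for the set of modules `𝒢 = {G i : i ∈ ι}`. -/
def Filt {ι : Type u} (G : ι → RightMod R) : ObjectProperty (RightMod R) := fun M =>
  ∃ (κ : Cardinal.{u}) (F : Ordinal.{u} → Submodule Rᵐᵒᵖ M), IsFiltration G M κ F

/-- A class of right modules is deconstructible if it is `Filt-𝒢` for some set `𝒢` of modules. -/
def IsDeconstructible (𝒳 : ObjectProperty (RightMod R)) : Prop :=
  ∃ (ι : Type u) (G : ι → RightMod R), 𝒳 = Filt G

/-- `f : X ⟶ M` is an `𝒳`-precover of `M`. -/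
def IsPrecover (𝒳 : ObjectProperty (RightMod R)) {X M : RightMod R} (f : X ⟶ M) : Prop :=
  𝒳 X ∧ ∀ X' : RightMod R, 𝒳 X' → Function.Surjective fun h : X' ⟶ X => h ≫ f

/-- A class is precovering if every right module has a precover in it. -/
def IsPrecovering (𝒳 : ObjectProperty (RightMod R)) : Prop :=
  ∀ M : RightMod R, ∃ (X : RightMod R) (f : X ⟶ M), IsPrecover 𝒳 f

/-- The trace of `𝒳` in `M`: the sum of the images of all morphisms from modules in `𝒳` to `M`. -/
def trace (𝒳 : ObjectProperty (RightMod R)) (M : RightMod R) : Submodule Rᵐᵒᵖ M :=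
  ⨆ (X : RightMod R) (_ : 𝒳 X) (f : X ⟶ M), LinearMap.range f.hom

/-- The class `𝒳^⊥` of all modules `N` with `Ext¹(X, N) = 0` for all `X` in `𝒳`. -/
def rightExtOrthogonal (𝒳 : ObjectProperty (RightMod R)) : ObjectProperty (RightMod R) := fun N =>
  ∀ X : RightMod R, 𝒳 X → Subsingleton (Abelian.Ext.{u} X N 1)

/-- `f : X ⟶ M` is a special `𝒳`-precover of `M`, in the sense that does not ask `f` to be epic:
`X` is in `𝒳`, the image of `f` is the trace of `𝒳` in `M`, and the kernel of `f` is in `𝒳^⊥`. -/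
def IsSpecialPrecover (𝒳 : ObjectProperty (RightMod R)) {X M : RightMod R} (f : X ⟶ M) : Prop :=
  𝒳 X ∧ LinearMap.range f.hom = trace 𝒳 M ∧
    rightExtOrthogonal 𝒳 (ModuleCat.of Rᵐᵒᵖ (LinearMap.ker f.hom))

/-- A class is special precovering if every right module has a special precover in it. -/
def IsSpecialPrecovering (𝒳 : ObjectProperty (RightMod R)) : Prop :=
  ∀ M : RightMod R, ∃ (X : RightMod R) (f : X ⟶ M), IsSpecialPrecover 𝒳 f

end RightMod

/-! The proof is a small object argument. Choose one free module `L` with epimorphisms `q i : L → G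
i`. Suppose `Q` is `G`-filtered and `p : Q → M` has the right lifting property against all
inclusions `ker (q i) → L`. Climbing a filtration of `X` (`IsFiltration.exists_lift`) extends this
property to `ker π → Y` for every epimorphism `π : Y → X` with `X` filtered. For `π = id` it says
that `p` is a precover, so its image is the trace; for `Y` free it gives `Ext¹(X, ker p) = 0`.

To build `p` (`exists_filt_hasLiftingAgainst`), copies of `L` are glued along the `ker (q i)`, one
at a time, so that each factor is some `G i` and the length is exactly a cardinal `κ`. By
`nonempty_factor_equiv` the gluing creates no unwanted relations. Taking `κ = 2 ^ ν` with `ν` large,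
there are at most `κ` lifting problems, each scheduled cofinally often, and each already lives at a
stage below `κ`. -/

/-! ### Lifting along filtrations -/

section Lifting

variable {S : Type*} [Ring S] {ι L Q M Y : Type*} [AddCommGroup L] [Module S L]
  [AddCommGroup Q] [Module S Q] [AddCommGroup M] [Module S M] [AddCommGroup Y] [Module S Y]

/-- `p` has the right lifting property with respect to all the inclusions `Ω i → L`. -/
def HasLiftingAgainst (Ω : ι → Submodule S L) (p : Q →ₗ[S] M) : Prop :=
  ∀ (i : ι) (h : Ω i →ₗ[S] Q) (g : L →ₗ[S] M), (∀ x : Ω i, p (h x) = g x) →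
    ∃ k : L →ₗ[S] Q, (∀ x : Ω i, k x = h x) ∧ ∀ x, p (k x) = g x

/-- By `hu`, `Ω i` is the preimage of `φ.domain` under `u`. Hence a lift `k` extending `φ ∘ u` kills
`ker u`, descends to `range u`, and agrees with `φ` on the overlap. -/
theorem HasLiftingAgainst.exists_extension {Ω : ι → Submodule S L} {p : Q →ₗ[S] M}
    (hp : HasLiftingAgainst Ω p) (g : Y →ₗ[S] M) (φ : Y →ₗ.[S] Q)
    (hφ : ∀ y : φ.domain, p (φ y) = g y) (i : ι) (u : L →ₗ[S] Y)
    (hu : ∀ l, u l ∈ φ.domain ↔ l ∈ Ω i) :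
    ∃ ψ : Y →ₗ.[S] Q, φ ≤ ψ ∧ ψ.domain = φ.domain ⊔ LinearMap.range u ∧
      ∀ y : ψ.domain, p (ψ y) = g y := by
  obtain ⟨k, hk, hpk⟩ := hp i
    (φ.toFun ∘ₗ (u.restrict (p := Ω i) (q := φ.domain) fun l hl => (hu l).2 hl)) (g ∘ₗ u)
    (fun x => hφ _)
  have hker : LinearMap.ker u ≤ LinearMap.ker k := by
    intro l hl
    have hl' : u l = 0 := hl
    have hm : l ∈ Ω i := (hu l).1 (by rw [hl']; exact zero_mem _)
    have h1 := hk ⟨l, hm⟩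
    have h2 : (u.restrict (p := Ω i) (q := φ.domain) fun l hl => (hu l).2 hl) ⟨l, hm⟩ = 0 :=
      Subtype.ext hl'
    rw [LinearMap.comp_apply, h2, map_zero] at h1
    exact h1
  let k' : LinearMap.range u →ₗ[S] Q :=
    (LinearMap.ker u).liftQ k hker ∘ₗ (u.quotKerEquivRange.symm : _ →ₗ[S] _)
  have hk' : ∀ l (h : u l ∈ LinearMap.range u), k' ⟨u l, h⟩ = k l := by
    intro l h
    have : u.quotKerEquivRange.symm ⟨u l, h⟩ = (LinearMap.ker u).mkQ l :=
      (LinearEquiv.symm_apply_eq _).2 rfl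
    simp only [k', LinearMap.comp_apply, LinearEquiv.coe_coe, this]
    rfl
  let χ : Y →ₗ.[S] Q := ⟨LinearMap.range u, k'⟩
  have hagree : ∀ (x : φ.domain) (y : χ.domain), (x : Y) = y → φ x = χ y := by
    rintro ⟨x, hx⟩ ⟨_, l, rfl⟩ (rfl : x = u l)
    exact ((hk' l ⟨l, rfl⟩).trans (hk ⟨l, (hu l).1 hx⟩)).symm
  refine ⟨φ.sup χ hagree, φ.left_le_sup χ hagree, LinearPMap.domain_sup _ _ _, ?_⟩
  rintro ⟨y, hy⟩
  have hy' : y ∈ φ.domain ⊔ χ.domain := hy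
  obtain ⟨a, ha, _, ⟨l, rfl⟩, rfl⟩ := Submodule.mem_sup.1 hy'
  refine (congrArg p (LinearPMap.sup_apply hagree ⟨a, ha⟩ ⟨u l, l, rfl⟩ ⟨a + u l, hy⟩ rfl)).trans ?_
  rw [map_add, hφ]
  exact (congrArg (fun z => g a + p z) (hk' l ⟨l, rfl⟩)).trans
    ((congrArg (g a + ·) (hpk l)).trans (map_add g a (u l)).symm)

end Lifting

namespace RightMod

variable {R : Type u} [Ring R]

/-- A morphism with the right lifting property against `Ω i → L`, where `L ⧸ Ω i ≅ G i` and `L` is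
projective, has the lifting property against `ker π → Y` for any epimorphism `π` from `Y` to a
`G`-filtered module. -/
theorem IsFiltration.exists_lift {ι : Type u} {G : ι → RightMod R} {X : RightMod R}
    {κ : Cardinal.{u}} {F : Ordinal.{u} → Submodule Rᵐᵒᵖ X} (hF : IsFiltration G X κ F)
    {L Q M Y : Type*} [AddCommGroup L] [Module Rᵐᵒᵖ L] [Module.Projective Rᵐᵒᵖ L]
    [AddCommGroup Q] [Module Rᵐᵒᵖ Q] [AddCommGroup M] [Module Rᵐᵒᵖ M]
    [AddCommGroup Y] [Module Rᵐᵒᵖ Y] (q : ∀ i, L →ₗ[Rᵐᵒᵖ] G i)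
    (hq : ∀ i, Function.Surjective (q i)) {p : Q →ₗ[Rᵐᵒᵖ] M}
    (hp : HasLiftingAgainst (fun i => LinearMap.ker (q i)) p)
    (π : Y →ₗ[Rᵐᵒᵖ] X) (hπ : Function.Surjective π) (h : LinearMap.ker π →ₗ[Rᵐᵒᵖ] Q)
    (g : Y →ₗ[Rᵐᵒᵖ] M) (hg : ∀ y : LinearMap.ker π, p (h y) = g y) :
    ∃ k : Y →ₗ[Rᵐᵒᵖ] Q, (∀ y : LinearMap.ker π, k y = h y) ∧ ∀ y, p (k y) = g y := by
  let φ₀ : Y →ₗ.[Rᵐᵒᵖ] Q := ⟨LinearMap.ker π, h⟩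
  -- Domains are indexed by sets of stages: unions of chains keep this form, and `s = ∅` yields `ker
  -- π` even when `κ = 0`.
  let T : Set (Y →ₗ.[Rᵐᵒᵖ] Q) := {φ | φ₀ ≤ φ ∧ (∀ y : φ.domain, p (φ y) = g y) ∧
    ∃ s : Set Ordinal.{u}, s ⊆ Set.Iio κ.ord ∧ φ.domain = (⨆ α ∈ s, F α).comap π}
  have hT₀ : φ₀ ∈ T := ⟨le_rfl, hg, ∅, by simp, by simp [φ₀]⟩
  obtain ⟨φ, -, hφ⟩ := zorn_le_nonempty₀ T (fun C hC hchain φ₁ hφ₁ => by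
    have hdir : DirectedOn (· ≤ ·) C := hchain.directedOn
    have hmem : ∀ x, x ∈ (LinearPMap.sSup C hdir).domain ↔ ∃ φ ∈ C, x ∈ φ.domain := by
      exact fun x => LinearPMap.mem_domain_sSup_iff ⟨φ₁, hφ₁⟩ hdir
    refine ⟨LinearPMap.sSup C hdir, ⟨(hC hφ₁).1.trans (LinearPMap.le_sSup hdir hφ₁), ?_, ?_⟩,
      fun φ hφ => LinearPMap.le_sSup hdir hφ⟩
    · rintro ⟨y, hy⟩
      obtain ⟨φ, hφ, hyφ⟩ := (hmem y).1 hy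
      rw [LinearPMap.sSup_apply hdir hφ ⟨y, hyφ⟩]
      exact (hC hφ).2.1 _
    · choose! s hs hs' using fun φ (hφ : φ ∈ C) => (hC hφ).2.2
      refine ⟨⋃ φ ∈ C, s φ, Set.iUnion₂_subset hs, ?_⟩
      apply le_antisymm
      · intro x hx
        obtain ⟨φ, hφ, hxφ⟩ := (hmem x).1 hx
        rw [hs' φ hφ] at hxφ
        have h1 : ⨆ α ∈ s φ, F α ≤ ⨆ α ∈ ⋃ φ ∈ C, s φ, F α :=
          biSup_mono fun α hα => Set.mem_biUnion hφ hα
        exact h1 hxφ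
      · have hle : ⨆ α ∈ ⋃ φ ∈ C, s φ, F α ≤ (LinearPMap.sSup C hdir).domain.map π := by
          refine iSup₂_le fun α hα => ?_
          obtain ⟨φ, hφ, hαφ⟩ := Set.mem_iUnion₂.1 hα
          have h1 : F α ≤ φ.domain.map π := by
            rw [hs' φ hφ, Submodule.map_comap_eq_of_surjective hπ]
            exact le_iSup₂_of_le α hαφ le_rfl
          exact h1.trans (Submodule.map_mono (LinearPMap.le_sSup hdir hφ).1)
        intro x hx
        obtain ⟨y, hy, hyx⟩ := hle hx
        have hker : x - y ∈ LinearMap.ker π := by simp [hyx]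
        have := add_mem ((LinearPMap.le_sSup hdir hφ₁).1 ((hC hφ₁).1.1 hker)) hy
        simpa using this) φ₀ hT₀
  obtain ⟨⟨hφ₀, hφg, s, hs, hdom⟩, hmax⟩ := hφ
  have hle : ∀ α < κ.ord, F α ≤ ⨆ α ∈ s, F α := by
    by_contra! hne
    let A : Set Ordinal.{u} := {α | α < κ.ord ∧ ¬ F α ≤ ⨆ α ∈ s, F α}
    have hA : A.Nonempty := hne
    obtain ⟨hα, hαs⟩ : sInf A ∈ A := csInf_mem hA
    have hmin : ∀ β < sInf A, F β ≤ ⨆ α ∈ s, F α := fun β hβ => by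
      by_contra hcon
      exact notMem_of_lt_csInf' hβ ⟨hβ.trans hα, hcon⟩
    generalize sInf A = α at hα hαs hmin
    rcases Ordinal.zero_or_succ_or_isSuccLimit α with rfl | ⟨β, rfl⟩ | hlim
    · exact hαs (by rw [hF.zero]; exact bot_le)
    · rw [Order.succ_eq_add_one] at hα hαs hmin
      have hβ : β < β + 1 := lt_add_one β
      -- A stage in `s` beyond `β` would already contain `F (β + 1)`.
      have hB : ⨆ α ∈ s, F α = F β := by
        refine le_antisymm (iSup₂_le fun γ hγ => ?_) (hmin β hβ)
        rcases le_or_gt γ β with h1 | h1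
        · exact hF.mono γ β h1 (hβ.trans hα)
        · exact absurd (le_iSup₂_of_le γ hγ (hF.mono _ γ (Order.add_one_le_of_lt h1) (hs hγ))) hαs
      rw [hB] at hdom hαs
      obtain ⟨i, ⟨e⟩⟩ := hF.factor β hα
      -- Projectivity of `L` lifts `q i` to `F (β + 1)` and then to `Y`; the preimage of `φ.domain`
      -- under the result is `ker (q i)`.
      obtain ⟨v, hv⟩ := Module.projective_lifting_property
        ((F β).submoduleOf (F (β + 1))).mkQ ((e.symm : _ →ₗ[Rᵐᵒᵖ] _) ∘ₗ q i)
        (Submodule.mkQ_surjective _)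
      obtain ⟨u, hu⟩ := Module.projective_lifting_property π ((F (β + 1)).subtype ∘ₗ v) hπ
      have hu' : ∀ l, π (u l) = v l := fun l => LinearMap.congr_fun hu l
      have hv' : ∀ l, ((F β).submoduleOf (F (β + 1))).mkQ (v l) = e.symm (q i l) :=
        fun l => LinearMap.congr_fun hv l
      have humem : ∀ l, u l ∈ φ.domain ↔ l ∈ LinearMap.ker (q i) := by
        intro l
        rw [hdom, Submodule.mem_comap, hu', LinearMap.mem_ker, ← e.symm.map_eq_zero_iff, ← hv',
          Submodule.mkQ_apply, Submodule.Quotient.mk_eq_zero]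
        rfl
      obtain ⟨ψ, hφψ, hψdom, hψg⟩ := hp.exists_extension g φ hφg i u humem
      have hψdom' : ψ.domain = (F (β + 1)).comap π := by
        rw [hψdom, hdom]
        apply le_antisymm
        · refine sup_le (Submodule.comap_mono (hF.mono _ _ hβ.le hα)) ?_
          rintro _ ⟨l, rfl⟩
          rw [Submodule.mem_comap, hu']
          exact (v l).2
        · intro x hx
          obtain ⟨l, hl⟩ := hq i (e (((F β).submoduleOf (F (β + 1))).mkQ ⟨π x, hx⟩))
          have h1 : ((F β).submoduleOf (F (β + 1))).mkQ (⟨π x, hx⟩ - v l) = 0 := by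
            rw [map_sub, hv', hl, e.symm_apply_apply, sub_self]
          rw [Submodule.mkQ_apply, Submodule.Quotient.mk_eq_zero] at h1
          have h2 : x - u l ∈ (F β).comap π := by
            rw [Submodule.mem_comap, map_sub, hu']
            exact h1
          exact Submodule.mem_sup.2 ⟨_, h2, u l, ⟨l, rfl⟩, sub_add_cancel _ _⟩
      have hψT : ψ ∈ T := ⟨hφ₀.trans hφψ, hψg, {β + 1}, by simpa using hα, by simpa using hψdom'⟩
      have h4 := (hmax hψT hφψ).1
      rw [hψdom', hdom] at h4
      apply hαs
      intro x hx
      obtain ⟨y, rfl⟩ := hπ x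
      exact h4 hx
    · refine hαs ?_
      rw [hF.continuous α hα hlim]
      exact iSup₂_le hmin
  have htop : φ.domain = ⊤ := by
    rw [hdom, eq_top_iff, ← Submodule.comap_top π, ← hF.union]
    exact Submodule.comap_mono (iSup₂_le hle)
  have hy : ∀ y, y ∈ φ.domain := fun y => htop ▸ Submodule.mem_top
  refine ⟨φ.toFun ∘ₗ LinearMap.id.codRestrict φ.domain hy, fun y => ?_, fun y => hφg ⟨y, hy y⟩⟩
  exact (hφ₀.2 (x := y) (y := ⟨y, hy y⟩) rfl).symm

end RightMod

theorem exists_wellFounded_fixpoint {I T : Type*} [LinearOrder I] [WellFoundedLT I] [Nonempty T]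
    (Φ : I → (I → T) → T) (hΦ : ∀ β c c', (∀ γ < β, c γ = c' γ) → Φ β c = Φ β c') :
    ∃ c : I → T, ∀ β, c β = Φ β c := by
  classical
  let t : T := Classical.arbitrary T
  let F : ∀ β : I, (∀ γ, γ < β → T) → T := fun β f =>
    Φ β fun γ => if h : γ < β then f γ h else t
  refine ⟨IsWellFounded.fix (· < ·) F, fun β => ?_⟩
  rw [IsWellFounded.fix_eq]
  exact hΦ _ _ _ fun γ hγ => by simp [hγ]

/-! ### Gluing cells by generators and relations -/

section Cells

variable {S L M I : Type*} [Ring S] [AddCommGroup L] [Module S L] [AddCommGroup M] [Module S M]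

/-- The map out of `I →₀ L` given on the `β`-th summand by the second component of `c β`. -/
noncomputable def cellMap (c : I → (L → I →₀ L) × (L →ₗ[S] M)) : (I →₀ L) →ₗ[S] M :=
  Finsupp.lsum ℕ fun β => (c β).2

@[simp]
theorem cellMap_single (c : I → (L → I →₀ L) × (L →ₗ[S] M)) (β : I) (l : L) :
    cellMap c (Finsupp.single β l) = (c β).2 l := by
  simp [cellMap]

/-- The relations gluing, for `β ∈ s`, the submodule `Ω β` of the `β`-th summand of `I →₀ L`
along the first component of `c β`. -/
noncomputable def cellRel (Ω : I → Submodule S L) (c : I → (L → I →₀ L) × (L →ₗ[S] M)) (s : Set I) :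
    Submodule S (I →₀ L) :=
  Submodule.span S {d | ∃ β ∈ s, ∃ ω ∈ Ω β, d = Finsupp.single β ω - (c β).1 ω}

theorem cellRel_mono (Ω : I → Submodule S L) (c : I → (L → I →₀ L) × (L →ₗ[S] M)) {s t : Set I}
    (h : s ⊆ t) : cellRel Ω c s ≤ cellRel Ω c t :=
  Submodule.span_mono fun _ ⟨β, hβ, H⟩ => ⟨β, h hβ, H⟩

theorem cellRel_congr (Ω : I → Submodule S L) {c c' : I → (L → I →₀ L) × (L →ₗ[S] M)} {s : Set I}
    (h : ∀ β ∈ s, c β = c' β) : cellRel Ω c s = cellRel Ω c' s := by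
  unfold cellRel
  congr 1
  ext d
  refine exists_congr fun β => and_congr_right fun hβ => ?_
  rw [h β hβ]

theorem cellMap_congr {c c' : I → (L → I →₀ L) × (L →ₗ[S] M)} {s : Set I}
    (h : ∀ β ∈ s, c β = c' β) {d : I →₀ L} (hd : d ∈ Finsupp.supported L S s) :
    cellMap c d = cellMap c' d := by
  simp only [cellMap, Finsupp.lsum_apply]
  exact Finsupp.sum_congr fun β hβ => by rw [h β (hd hβ)]

variable [LinearOrder I]

/-- The pair `x` describes a square from `Ω β → L` to the morphism induced by `cellMap c` on the
quotient of the summands below `β` by the relations below `β`. -/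
def IsAttachable (Ω : I → Submodule S L) (c : I → (L → I →₀ L) × (L →ₗ[S] M)) (β : I)
    (x : (L → I →₀ L) × (L →ₗ[S] M)) : Prop :=
  (∀ ω ∈ Ω β, x.1 ω ∈ Finsupp.supported L S (Set.Iio β)) ∧
  (∀ ω ∈ Ω β, cellMap c (x.1 ω) = x.2 ω) ∧
  ∀ (a : S), ∀ ω ∈ Ω β, ∀ ω' ∈ Ω β,
    x.1 (a • ω + ω') - a • x.1 ω - x.1 ω' ∈ cellRel Ω c (Set.Iio β)

theorem IsAttachable.congr {Ω : I → Submodule S L} {c c' : I → (L → I →₀ L) × (L →ₗ[S] M)} {β : I}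
    {x : (L → I →₀ L) × (L →ₗ[S] M)} (h : ∀ γ < β, c γ = c' γ) (hx : IsAttachable Ω c β x) :
    IsAttachable Ω c' β x := by
  refine ⟨hx.1, fun ω hω => ?_, fun a ω hω ω' hω' => ?_⟩
  · rw [← hx.2.1 ω hω, cellMap_congr (s := Set.Iio β) h (hx.1 ω hω)]
  · rw [← cellRel_congr Ω (s := Set.Iio β) h]
    exact hx.2.2 a ω hω ω' hω'

/-- The fallback cell: it splits off a summand `L ⧸ Ω β`, mapped to `M` by zero. -/
theorem isAttachable_zero (Ω : I → Submodule S L) (c : I → (L → I →₀ L) × (L →ₗ[S] M)) (β : I) :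
    IsAttachable Ω c β 0 :=
  ⟨fun _ _ => zero_mem _, fun _ _ => by simp, fun _ _ _ _ _ => by simp⟩

/-- Cells can be attached one at a time so that the prescribed cell `x β` is attached whenever this
makes sense. -/
theorem exists_attachable [WellFoundedLT I] (Ω : I → Submodule S L)
    (x : I → (L → I →₀ L) × (L →ₗ[S] M)) :
    ∃ c : I → (L → I →₀ L) × (L →ₗ[S] M), (∀ β, IsAttachable Ω c β (c β)) ∧
      ∀ β, IsAttachable Ω c β (x β) → c β = x β := by
  classical
  obtain ⟨c, hc⟩ := exists_wellFounded_fixpoint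
    (fun (β : I) (c : I → (L → I →₀ L) × (L →ₗ[S] M)) =>
      if IsAttachable Ω c β (x β) then x β else 0)
    (fun β c c' h => if_congr ⟨IsAttachable.congr h, IsAttachable.congr fun γ hγ => (h γ hγ).symm⟩
      rfl rfl)
  refine ⟨c, fun β => ?_, fun β h => ?_⟩
  · rw [hc β]
    split_ifs with h
    exacts [h, isAttachable_zero Ω c β]
  · rw [hc β, if_pos h]

/-- Only finitely many relations are involved, so there is a largest index; the alternative `d = 0`
covers empty `s`. -/
theorem mem_cellRel_iff_exists {Ω : I → Submodule S L} {c : I → (L → I →₀ L) × (L →ₗ[S] M)}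
    {s : Set I} {d : I →₀ L} (hd : d ∈ cellRel Ω c s) :
    d = 0 ∨ ∃ γ ∈ s, d ∈ cellRel Ω c (Set.Iic γ) := by
  induction hd using Submodule.span_induction with
  | mem d hd =>
    obtain ⟨γ, hγ, ω, hω, rfl⟩ := hd
    exact Or.inr ⟨γ, hγ, Submodule.subset_span ⟨γ, le_rfl, ω, hω, rfl⟩⟩
  | zero => exact Or.inl rfl
  | add d e _ _ hd he =>
    rcases hd with rfl | ⟨γ, hγ, hd⟩
    · rwa [zero_add]
    rcases he with rfl | ⟨δ, hδ, he⟩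
    · rw [add_zero]; exact Or.inr ⟨γ, hγ, hd⟩
    refine Or.inr ⟨max γ δ, by rcases max_choice γ δ with h | h <;> rwa [h], add_mem ?_ ?_⟩
    · exact cellRel_mono Ω c (Set.Iic_subset_Iic.2 (le_max_left _ _)) hd
    · exact cellRel_mono Ω c (Set.Iic_subset_Iic.2 (le_max_right _ _)) he
  | smul a d _ hd =>
    rcases hd with rfl | ⟨γ, hγ, hd⟩
    · exact Or.inl (smul_zero a)
    · exact Or.inr ⟨γ, hγ, Submodule.smul_mem _ a hd⟩

variable {Ω : I → Submodule S L} {c : I → (L → I →₀ L) × (L →ₗ[S] M)}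
  (hc : ∀ β, IsAttachable Ω c β (c β))

include hc

theorem cellRel_le_ker : cellRel Ω c Set.univ ≤ LinearMap.ker (cellMap c) := by
  refine Submodule.span_le.2 ?_
  rintro _ ⟨β, -, ω, hω, rfl⟩
  rw [SetLike.mem_coe, LinearMap.mem_ker, map_sub, cellMap_single, (hc β).2.1 ω hω, sub_self]

theorem cellRel_le_supported (α : I) :
    cellRel Ω c (Set.Iic α) ≤ Finsupp.supported L S (Set.Iic α) := by
  refine Submodule.span_le.2 ?_
  rintro _ ⟨β, hβ, ω, hω, rfl⟩
  exact sub_mem (Finsupp.single_mem_supported S ω hβ)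
    (Finsupp.supported_mono (Set.Iio_subset_Iic_self.trans (Set.Iic_subset_Iic.2 hβ))
      ((hc β).1 ω hω))

/-- Attaching maps are linear only modulo earlier relations, so the value at `0` need not vanish. -/
theorem attach_zero_mem (α : I) : (c α).1 0 ∈ cellRel Ω c (Set.Iio α) := by
  have := (hc α).2.2 1 0 (zero_mem _) 0 (zero_mem _)
  simpa using this

theorem exists_sub_mem_cellRel {α : I} {d : I →₀ L} (hd : d ∈ cellRel Ω c (Set.Iic α)) :
    ∃ ω ∈ Ω α, d - (Finsupp.single α ω - (c α).1 ω) ∈ cellRel Ω c (Set.Iio α) := by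
  induction hd using Submodule.span_induction with
  | mem d hd =>
    obtain ⟨γ, hγ, ω, hω, rfl⟩ := hd
    rcases lt_or_eq_of_le (show γ ≤ α from hγ) with h | rfl
    · refine ⟨0, zero_mem _, ?_⟩
      rw [Finsupp.single_zero, zero_sub, sub_neg_eq_add]
      exact add_mem (Submodule.subset_span ⟨γ, h, ω, hω, rfl⟩) (attach_zero_mem hc α)
    · exact ⟨ω, hω, by rw [sub_self]; exact zero_mem _⟩
  | zero =>
    refine ⟨0, zero_mem _, ?_⟩
    simpa using attach_zero_mem hc α
  | add d e _ _ hd he =>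
    obtain ⟨ω, hω, hd⟩ := hd
    obtain ⟨ω', hω', he⟩ := he
    refine ⟨ω + ω', add_mem hω hω', ?_⟩
    have h1 := add_mem (add_mem hd he) ((hc α).2.2 1 ω hω ω' hω')
    convert h1 using 1
    rw [Finsupp.single_add]
    simp only [one_smul]
    abel
  | smul a d _ hd =>
    obtain ⟨ω, hω, hd⟩ := hd
    refine ⟨a • ω, Submodule.smul_mem _ a hω, ?_⟩
    have h1 := add_mem (Submodule.smul_mem _ a hd)
      (add_mem ((hc α).2.2 a ω hω 0 (zero_mem _)) (attach_zero_mem hc α))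
    convert h1 using 1
    rw [← Finsupp.smul_single, add_zero, smul_sub, smul_sub]
    abel

/-- Modulo earlier relations, `d` is one relation at `α`, given by some `ω ∈ Ω α`, and comparing
supports gives `d α = ω`. If `α = β` this is the claim; if `α > β`, then `ω = 0` and `d` is a
relation of smaller index. -/
theorem apply_mem_of_mem_cellRel_Iic [WellFoundedLT I] (α : I) :
    ∀ d ∈ cellRel Ω c (Set.Iic α), ∀ β, d ∈ Finsupp.supported L S (Set.Iic β) → d β ∈ Ω β := by
  induction α using WellFoundedLT.induction with
  | ind α ih =>
    intro d hd β hβ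
    rcases lt_trichotomy α β with h | rfl | h
    · have h1 := cellRel_le_supported hc α hd
      rw [Finsupp.mem_supported'] at h1
      rw [h1 β (by simpa using h)]
      exact zero_mem _
    all_goals
      obtain ⟨ω, hω, h1⟩ := exists_sub_mem_cellRel hc hd
      have h2 : cellRel Ω c (Set.Iio α) ≤ Finsupp.supported L S (Set.Iio α) := by
        intro e he
        rcases mem_cellRel_iff_exists he with rfl | ⟨γ, hγ, he⟩
        · exact zero_mem _
        · exact Finsupp.supported_mono (Set.Iic_subset_Iio.2 hγ) (cellRel_le_supported hc γ he)
      have h3 := (Finsupp.mem_supported' S _).1 (h2 h1) α (by simp)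
      have h4 := (Finsupp.mem_supported' S _).1 ((hc α).1 ω hω) α (by simp)
      simp only [Finsupp.sub_apply, Finsupp.single_eq_same, h4, sub_zero] at h3
      have h5 : d α = ω := sub_eq_zero.1 h3
    · rwa [h5]
    · have h6 := (Finsupp.mem_supported' S _).1 hβ α (by simpa using h)
      obtain rfl : 0 = ω := h6.symm.trans h5
      have h7 : d ∈ cellRel Ω c (Set.Iio α) := by
        have := sub_mem h1 (attach_zero_mem hc α)
        simpa using this
      rcases mem_cellRel_iff_exists h7 with rfl | ⟨γ, hγ, h8⟩
      · exact zero_mem _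
      · exact ih γ hγ d h8 β hβ

theorem apply_mem_of_mem_cellRel [WellFoundedLT I] {d : I →₀ L} (hd : d ∈ cellRel Ω c Set.univ)
    {β : I} (hβ : d ∈ Finsupp.supported L S (Set.Iic β)) : d β ∈ Ω β := by
  rcases mem_cellRel_iff_exists hd with rfl | ⟨γ, -, hγ⟩
  · exact zero_mem _
  · exact apply_mem_of_mem_cellRel_Iic hc γ d hγ β hβ

/-- The consecutive factors of the filtration by cells. -/
theorem nonempty_factor_equiv [WellFoundedLT I] (β : I) :
    Nonempty ((((Finsupp.supported L S (Set.Iic β)).map (cellRel Ω c Set.univ).mkQ :) ⧸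
      ((Finsupp.supported L S (Set.Iio β)).map (cellRel Ω c Set.univ).mkQ).submoduleOf
        ((Finsupp.supported L S (Set.Iic β)).map (cellRel Ω c Set.univ).mkQ)) ≃ₗ[S] L ⧸ Ω β) := by
  set W := cellRel Ω c Set.univ with hW
  set V := (Finsupp.supported L S (Set.Iic β)).map W.mkQ with hV
  set U := (Finsupp.supported L S (Set.Iio β)).map W.mkQ with hU
  let f : L →ₗ[S] V := (W.mkQ ∘ₗ Finsupp.lsingle β).codRestrict V fun l =>
    Submodule.mem_map_of_mem (Finsupp.single_mem_supported S l le_rfl)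
  have hker : LinearMap.ker ((U.submoduleOf V).mkQ ∘ₗ f) = Ω β := by
    ext l
    rw [LinearMap.mem_ker, LinearMap.comp_apply, Submodule.mkQ_apply,
      Submodule.Quotient.mk_eq_zero]
    change W.mkQ (Finsupp.single β l) ∈ U ↔ _
    constructor
    · rintro ⟨d, hd, hdl⟩
      have h1 : Finsupp.single β l - d ∈ W := by
        rw [← Submodule.Quotient.mk_eq_zero, Submodule.Quotient.mk_sub, sub_eq_zero]
        exact hdl.symm
      -- The coefficient at `β` of this relation is `l`, because `d` is supported strictly below
      -- `β`.
      have h2 := apply_mem_of_mem_cellRel hc h1 (β := β)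
        (sub_mem (Finsupp.single_mem_supported S l le_rfl)
          (Finsupp.supported_mono Set.Iio_subset_Iic_self hd))
      simpa [(Finsupp.mem_supported' S _).1 hd β (by simp)] using h2
    · intro hl
      refine ⟨(c β).1 l, (hc β).1 l hl, Eq.symm ?_⟩
      rw [← sub_eq_zero, ← map_sub, Submodule.mkQ_apply, Submodule.Quotient.mk_eq_zero]
      exact Submodule.subset_span ⟨β, Set.mem_univ _, l, hl, rfl⟩
  have hsurj : Function.Surjective ((U.submoduleOf V).mkQ ∘ₗ f) := by
    intro z
    obtain ⟨⟨_, d, hd, rfl⟩, rfl⟩ := Submodule.mkQ_surjective _ z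
    refine ⟨d β, ?_⟩
    rw [LinearMap.comp_apply, ← sub_eq_zero, ← map_sub, Submodule.mkQ_apply,
      Submodule.Quotient.mk_eq_zero]
    change W.mkQ (Finsupp.single β (d β)) - W.mkQ d ∈ U
    rw [← map_sub]
    refine Submodule.mem_map_of_mem ((Finsupp.mem_supported' S _).2 fun γ hγ => ?_)
    rcases eq_or_ne γ β with rfl | hne
    · simp
    · rw [Finsupp.sub_apply, Finsupp.single_eq_of_ne hne,
        (Finsupp.mem_supported' S _).1 hd γ (fun h => hγ (lt_of_le_of_ne h hne)), sub_zero]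
  exact ⟨(((U.submoduleOf V).mkQ ∘ₗ f).quotKerEquivOfSurjective hsurj).symm.trans
    (Submodule.quotEquivOfEq _ _ hker)⟩

end Cells

/-! ### Bookkeeping and cofinality -/

section Cardinal

open Cardinal

/-- Via an injection of `T × κ` into `κ`, each `t` is listed `κ` times, whereas a proper initial
segment of `κ.ord` has fewer than `κ` elements. -/
theorem exists_bookkeeping {κ : Cardinal.{u}} (hκ : ℵ₀ ≤ κ) {T : Type u} [Nonempty T]
    (hT : #T ≤ κ) : ∃ b : κ.ord.ToType → T, ∀ t β, ∃ γ, β ≤ γ ∧ b γ = t := by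
  have h0 : #(T × κ.ord.ToType) ≤ #κ.ord.ToType := by
    rw [mk_prod, lift_id, lift_id, mk_ord_toType]
    exact (mul_le_mul_left hT κ).trans (mul_eq_self hκ).le
  obtain ⟨e⟩ := h0
  have : Nonempty κ.ord.ToType := by
    rw [← mk_ne_zero_iff, mk_ord_toType]
    exact (aleph0_pos.trans_le hκ).ne'
  obtain ⟨s, hs⟩ : ∃ s, Function.LeftInverse s e :=
    ⟨_, Function.leftInverse_invFun e.injective⟩
  refine ⟨fun β => (s β).1, fun t β => ?_⟩
  by_contra! hcon
  have h1 : #κ.ord.ToType ≤ #(Set.Iio β) := by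
    refine mk_le_of_injective (f := fun γ => ⟨e (t, γ), ?_⟩) ?_
    · by_contra h
      exact hcon (e (t, γ)) (not_lt.1 h) (by rw [hs])
    · intro γ γ' h
      have := e.injective (Subtype.ext_iff.1 h)
      exact (Prod.ext_iff.1 this).2
  rw [mk_ord_toType] at h1
  exact absurd (mk_Iio_lt β (by simp)) (not_lt.2 (by rwa [mk_ord_toType]))

theorem exists_forall_lt_ord_toType {κ : Cardinal.{u}} {A : Type u} (hA : #A < κ.ord.cof)
    (f : A → κ.ord.ToType) (hκ : ℵ₀ ≤ κ) : ∃ β, ∀ a, f a < β := by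
  have h : ⨆ a, ((f a).toOrd : Ordinal.{u}) < κ.ord :=
    Ordinal.iSup_lt_of_lt_cof hA fun a => (f a).toOrd.2
  refine ⟨Ordinal.ToType.mk ⟨(⨆ a, ((f a).toOrd : Ordinal.{u})) + 1,
    (isSuccLimit_ord hκ).add_one_lt h⟩, fun a => ?_⟩
  rw [← OrderIso.symm_apply_lt]
  refine Subtype.mk_lt_mk.2 ?_
  rw [Order.lt_add_one_iff]
  exact Ordinal.le_iSup (fun a => ((f a).toOrd : Ordinal.{u})) a

end Cardinal

/-! ### The small object argument -/

namespace RightMod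

open Cardinal

variable {R : Type u} [Ring R]

theorem isFiltration_cells {ι : Type u} {G : ι → RightMod R} {L M : Type u}
    [AddCommGroup L] [Module Rᵐᵒᵖ L] [AddCommGroup M] [Module Rᵐᵒᵖ M] (q : ∀ i, L →ₗ[Rᵐᵒᵖ] G i)
    (hq : ∀ i, Function.Surjective (q i)) {κ : Cardinal.{u}} (hκ : ℵ₀ ≤ κ)
    (i : κ.ord.ToType → ι)
    {c : κ.ord.ToType → (L → κ.ord.ToType →₀ L) × (L →ₗ[Rᵐᵒᵖ] M)}
    (hc : ∀ β, IsAttachable (fun β => LinearMap.ker (q (i β))) c β (c β)) :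
    IsFiltration G (ModuleCat.of Rᵐᵒᵖ
      ((κ.ord.ToType →₀ L) ⧸ cellRel (fun β => LinearMap.ker (q (i β))) c Set.univ)) κ
      (fun α => (Finsupp.supported L Rᵐᵒᵖ {β | (β.toOrd : Ordinal.{u}) < α}).map
        (cellRel (fun β => LinearMap.ker (q (i β))) c Set.univ).mkQ) where
  zero := by
    simp
  mono α β h _ := Submodule.map_mono (Finsupp.supported_mono fun γ hγ => lt_of_lt_of_le (show (γ.toOrd : Ordinal.{u}) < α from hγ) h)
  continuous α hα hlim := by
    refine le_antisymm ?_ (iSup₂_le fun β hβ => Submodule.map_mono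
      (Finsupp.supported_mono fun γ hγ => lt_trans (show (γ.toOrd : Ordinal.{u}) < β from hγ) hβ))
    rintro _ ⟨d, hd, rfl⟩
    have hfin : ∃ β < α, d ∈ Finsupp.supported L Rᵐᵒᵖ
        {γ : κ.ord.ToType | (γ.toOrd : Ordinal.{u}) < β} := by
      -- Stages use strict inequalities, hence the successor; it stays below the limit `α`.
      refine ⟨d.support.sup fun γ => (γ.toOrd : Ordinal.{u}) + 1, ?_, fun γ hγ => ?_⟩
      · rw [Finset.sup_lt_iff hlim.bot_lt]
        exact fun γ hγ => hlim.add_one_lt (hd hγ)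
      · exact (lt_add_one _).trans_le
          (Finset.le_sup (f := fun γ : κ.ord.ToType => (γ.toOrd : Ordinal.{u}) + 1) hγ)
    obtain ⟨β, hβ, hd⟩ := hfin
    exact Submodule.mem_iSup_of_mem β (Submodule.mem_iSup_of_mem hβ (Submodule.mem_map_of_mem hd))
  union := by
    have hlim := isSuccLimit_ord hκ
    rw [eq_top_iff]
    intro z _
    obtain ⟨d, rfl⟩ := Submodule.mkQ_surjective _ z
    have hβ : d.support.sup (fun γ => (γ.toOrd : Ordinal.{u}) + 1) < κ.ord := by
      rw [Finset.sup_lt_iff hlim.bot_lt]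
      exact fun γ hγ => hlim.add_one_lt γ.toOrd.2
    refine Submodule.mem_iSup_of_mem _ (Submodule.mem_iSup_of_mem hβ
      (Submodule.mem_map_of_mem fun γ hγ => ?_))
    exact (lt_add_one _).trans_le
      (Finset.le_sup (f := fun γ : κ.ord.ToType => (γ.toOrd : Ordinal.{u}) + 1) hγ)
  factor α hα := by
    let β : κ.ord.ToType := Ordinal.ToType.mk ⟨α, (lt_add_one α).trans hα⟩
    have hβ : (β.toOrd : Ordinal.{u}) = α := by simp [β]
    have h1 : {γ : κ.ord.ToType | (γ.toOrd : Ordinal.{u}) < α} = Set.Iio β := by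
      ext γ
      rw [← hβ]
      exact (Subtype.coe_lt_coe.trans Ordinal.ToType.mk.symm.lt_iff_lt)
    have h2 : {γ : κ.ord.ToType | (γ.toOrd : Ordinal.{u}) < α + 1} = Set.Iic β := by
      ext γ
      rw [← hβ, Set.mem_ofPred_eq, Order.lt_add_one_iff]
      exact (Subtype.coe_le_coe.trans Ordinal.ToType.mk.symm.le_iff_le)
    rw [h1, h2]
    obtain ⟨e⟩ := nonempty_factor_equiv hc β
    exact ⟨i β, ⟨e.trans ((q (i β)).quotKerEquivOfSurjective (hq _))⟩⟩

/-- The small object argument, attaching one cell at a time. -/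
theorem exists_filt_hasLiftingAgainst {ι : Type u} [Nonempty ι] (G : ι → RightMod R) {L : Type u}
    [AddCommGroup L] [Module Rᵐᵒᵖ L] (q : ∀ i, L →ₗ[Rᵐᵒᵖ] G i)
    (hq : ∀ i, Function.Surjective (q i)) (M : RightMod R) :
    ∃ (Q : RightMod R) (p : Q ⟶ M), Filt G Q ∧
      HasLiftingAgainst (fun i => LinearMap.ker (q i)) p.hom := by
  classical
  let ν : Cardinal.{u} := max (max ℵ₀ #ι) (max (max #Rᵐᵒᵖ #L) #M)
  have hν : ℵ₀ ≤ ν := (le_max_left _ _).trans (le_max_left _ _)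
  have hι : #ι ≤ ν := (le_max_right _ _).trans (le_max_left _ _)
  have hS : #Rᵐᵒᵖ ≤ ν := (le_max_left _ _).trans ((le_max_left _ _).trans (le_max_right _ _))
  have hL : #L ≤ ν := (le_max_right _ _).trans ((le_max_left _ _).trans (le_max_right _ _))
  have hM : #M ≤ ν := (le_max_right _ _).trans (le_max_right _ _)
  -- This choice gives both cofinality greater than `ν` and `κ ^ ν = κ`.
  let κ : Cardinal.{u} := 2 ^ ν
  have hνκ : ν < κ := cantor ν
  have hκ : ℵ₀ ≤ κ := hν.trans hνκ.le
  have hcof : ν < κ.ord.cof := lt_cof_ord_power hν one_lt_two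
  have hpow : κ ^ ν = κ := by
    rw [← power_mul, mul_eq_self hν]
  let I := κ.ord.ToType
  have hI : #I = κ := mk_ord_toType κ
  have hIne : Nonempty I := by
    rw [← mk_ne_zero_iff, hI]
    exact (aleph0_pos.trans_le hκ).ne'
  have hD : #(I →₀ L) ≤ κ := by
    rcases subsingleton_or_nontrivial L with h | h
    · exact (le_one_iff_subsingleton.2 inferInstance).trans (one_le_aleph0.trans hκ)
    · have : Infinite I := infinite_iff.2 (hI ▸ hκ)
      rw [mk_finsupp_of_infinite, hI]
      exact max_le le_rfl (hL.trans hνκ.le)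
  have hT : #(ι × (L → I →₀ L) × (L →ₗ[Rᵐᵒᵖ] M)) ≤ κ := by
    have h1 : #(L → I →₀ L) ≤ κ := by
      rw [← power_def, ← hpow]
      exact (power_le_power_right hD).trans (power_le_power_left (aleph0_pos.trans_le hκ).ne' hL)
    have h2 : #(L →ₗ[Rᵐᵒᵖ] M) ≤ κ := by
      refine (mk_le_of_injective (DFunLike.coe_injective (F := L →ₗ[Rᵐᵒᵖ] M))).trans ?_
      rw [← power_def, ← hpow]
      exact (power_le_power_right (hM.trans hνκ.le)).trans
        (power_le_power_left (aleph0_pos.trans_le hκ).ne' hL)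
    rw [mk_prod, mk_prod, lift_id, lift_id, lift_id, lift_id]
    calc _ ≤ κ * (κ * κ) := mul_le_mul' (hι.trans hνκ.le) (mul_le_mul' h1 h2)
      _ = κ := by rw [mul_eq_self hκ, mul_eq_self hκ]
  obtain ⟨b, hb⟩ := exists_bookkeeping hκ hT
  obtain ⟨c, hc, hcb⟩ := exists_attachable (fun β => LinearMap.ker (q (b β).1)) (fun β => (b β).2)
  have hfilt := isFiltration_cells q hq hκ (fun β => (b β).1) hc
  set W := cellRel (fun β => LinearMap.ker (q (b β).1)) c Set.univ with hW
  refine ⟨ModuleCat.of Rᵐᵒᵖ ((I →₀ L) ⧸ W), ModuleCat.ofHom (W.liftQ (cellMap c)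
    (cellRel_le_ker hc)), ⟨κ, _, hfilt⟩, fun i h g hg => ?_⟩
  -- Representatives need not depend linearly on `x`; this is why attaching maps are mere functions.
  choose H hH using fun x : LinearMap.ker (q i) => Submodule.mkQ_surjective W (h x)
  let H' : L → I →₀ L := fun l => if hl : l ∈ LinearMap.ker (q i) then H ⟨l, hl⟩ else 0
  have hH' : ∀ x : LinearMap.ker (q i), W.mkQ (H' x) = h x := fun x => by
    simp only [H', dif_pos x.2, Subtype.coe_eta, hH]
  have hbound : ∀ d : I →₀ L, ∃ β, d ∈ Finsupp.supported L Rᵐᵒᵖ (Set.Iio β) := by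
    intro d
    obtain ⟨β, hβ⟩ := exists_forall_lt_ord_toType (κ := κ) (A := d.support)
      (((lt_aleph0_of_finite _).trans_le hν).trans hcof) Subtype.val hκ
    exact ⟨β, fun γ hγ => hβ ⟨γ, hγ⟩⟩
  have hrel : ∀ d ∈ W, ∃ β, d ∈ cellRel (fun β => LinearMap.ker (q (b β).1)) c (Set.Iic β) := by
    intro d hd
    rcases mem_cellRel_iff_exists hd with rfl | ⟨β, -, hβ⟩
    · exact ⟨Classical.arbitrary I, zero_mem _⟩
    · exact ⟨β, hβ⟩
  have hlin : ∀ (a : Rᵐᵒᵖ) (x y : LinearMap.ker (q i)),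
      H' (a • (x : L) + y) - a • H' x - H' y ∈ W := by
    intro a x y
    have h1 : W.mkQ (H' (a • (x : L) + y) - a • H' x - H' y) = 0 := by
      have h2 := hH' (a • x + y)
      rw [map_add, map_smul, Submodule.coe_add, Submodule.coe_smul] at h2
      rw [map_sub, map_sub, map_smul, h2, hH', hH']
      abel
    rwa [Submodule.mkQ_apply, Submodule.Quotient.mk_eq_zero] at h1
  -- The supports and the linearity relations form two families of size at most `ν`, so both are
  -- bounded below `κ`.
  choose β₁ hβ₁ using fun x : LinearMap.ker (q i) => hbound (H' x)
  choose β₂ hβ₂ using fun z : Rᵐᵒᵖ × LinearMap.ker (q i) × LinearMap.ker (q i) =>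
    hrel _ (hlin z.1 z.2.1 z.2.2)
  have hK : #(LinearMap.ker (q i)) ≤ ν := (mk_subtype_le _).trans hL
  obtain ⟨δ₁, hδ₁⟩ := exists_forall_lt_ord_toType (hK.trans_lt hcof) β₁ hκ
  obtain ⟨δ₂, hδ₂⟩ := exists_forall_lt_ord_toType (κ := κ) (lt_of_le_of_lt (by
    simp only [mk_prod, lift_id]
    calc _ ≤ ν * (ν * ν) := mul_le_mul' hS (mul_le_mul' hK hK)
      _ = ν := by rw [mul_eq_self hν, mul_eq_self hν]) hcof) β₂ hκ
  obtain ⟨β, hβ, hbβ⟩ := hb (i, H', g) (max δ₁ δ₂)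
  have hatt : IsAttachable (fun β => LinearMap.ker (q (b β).1)) c β (b β).2 := by
    rw [IsAttachable, hbβ]
    refine ⟨fun ω hω => ?_, fun ω hω => ?_, fun a ω hω ω' hω' => ?_⟩
    · exact Finsupp.supported_mono
        (Set.Iio_subset_Iio ((hδ₁ _).le.trans ((le_max_left _ _).trans hβ))) (hβ₁ ⟨ω, hω⟩)
    · rw [← hg ⟨ω, hω⟩, ← hH' ⟨ω, hω⟩]
      rfl
    · exact cellRel_mono _ _
        (Set.Iic_subset_Iio.2 ((hδ₂ _).trans_le ((le_max_right _ _).trans hβ)))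
        (hβ₂ (a, ⟨ω, hω⟩, ⟨ω', hω'⟩))
  have hcβ := hcb β hatt
  rw [hbβ] at hcβ
  -- The cell attached at `β` is itself the required lift.
  refine ⟨W.mkQ ∘ₗ Finsupp.lsingle β, fun x => ?_, fun l => ?_⟩
  · rw [← hH', LinearMap.comp_apply, ← sub_eq_zero, ← map_sub, Submodule.mkQ_apply,
      Submodule.Quotient.mk_eq_zero]
    refine Submodule.subset_span ⟨β, Set.mem_univ _, x, ?_, ?_⟩
    · change (x : L) ∈ LinearMap.ker (q (b β).1)
      rw [hbβ]; exact x.2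
    · rw [hcβ]; rfl
  · change cellMap c (Finsupp.single β l) = g l
    rw [cellMap_single, hcβ]

end RightMod

/-! ### Special precovers -/

namespace RightMod

variable {R : Type u} [Ring R]

theorem filt_of_subsingleton {ι : Type u} (G : ι → RightMod R) (X : RightMod R) [Subsingleton X] :
    Filt G X :=
  ⟨0, fun _ => ⊥, ⟨rfl, fun _ _ _ _ => le_rfl, fun α h => by simp at h,
    Subsingleton.elim _ _, fun α h => by simp at h⟩⟩

/-- Lifting criterion for the vanishing of `Ext¹(X, ker p)`. -/
theorem subsingleton_ext_of_exists_lift {X Q M : RightMod R} (p : Q ⟶ M) {Y : Type u}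
    [AddCommGroup Y] [Module Rᵐᵒᵖ Y] [Module.Projective Rᵐᵒᵖ Y] (π : Y →ₗ[Rᵐᵒᵖ] X)
    (hπ : Function.Surjective π)
    (H : ∀ h : LinearMap.ker π →ₗ[Rᵐᵒᵖ] Q, (∀ y, p.hom (h y) = 0) → ∃ k : Y →ₗ[Rᵐᵒᵖ] Q,
      (∀ y : LinearMap.ker π, k y = h y) ∧ ∀ y, p.hom (k y) = 0) :
    Subsingleton (Abelian.Ext.{u} X (ModuleCat.of Rᵐᵒᵖ (LinearMap.ker p.hom)) 1) := by
  let T : ShortComplex (RightMod R) := ShortComplex.mk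
    (ModuleCat.ofHom (LinearMap.ker π).subtype) (ModuleCat.ofHom (Y := X) π)
    (ModuleCat.hom_ext (LinearMap.ext fun x => x.2))
  have hT : T.ShortExact :=
    { exact := (ShortComplex.ShortExact.moduleCat_exact_iff_function_exact T).2
        (LinearMap.exact_subtype_ker_map π)
      mono_f := (ModuleCat.mono_iff_injective _).2 (Submodule.subtype_injective _)
      epi_g := (ModuleCat.epi_iff_surjective _).2 hπ }
  have : Projective T.X₂ := by
    change Projective (ModuleCat.of Rᵐᵒᵖ Y)
    infer_instance
  refine subsingleton_of_forall_eq 0 fun e => ?_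
  -- Since `Y` is projective, each class comes from a map `ker π → ker p`; extending that map to `Y`
  -- kills the class.
  obtain ⟨x, rfl⟩ := Abelian.Ext.contravariant_sequence_exact₃ hT _ e
    (Abelian.Ext.eq_zero_of_projective _) (add_zero 1)
  obtain ⟨h, rfl⟩ := (Abelian.Ext.mk₀_bijective _ _).2 x
  obtain ⟨k, hk, hpk⟩ := H ((LinearMap.ker p.hom).subtype ∘ₗ h.hom) fun y => (h.hom y).2
  let k' : T.X₂ ⟶ ModuleCat.of Rᵐᵒᵖ (LinearMap.ker p.hom) :=
    ModuleCat.ofHom (k.codRestrict (LinearMap.ker p.hom) hpk)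
  have hk' : T.f ≫ k' = h := by
    ext y
    exact hk y
  rw [← hk', ← Abelian.Ext.mk₀_comp_mk₀]
  exact hT.extClass_comp_assoc _

/-- A morphism from a filtered module with the lifting property is a special precover. -/
theorem isSpecialPrecover_of_hasLiftingAgainst {ι : Type u} {G : ι → RightMod R} {L : Type u}
    [AddCommGroup L] [Module Rᵐᵒᵖ L] [Module.Projective Rᵐᵒᵖ L] (q : ∀ i, L →ₗ[Rᵐᵒᵖ] G i)
    (hq : ∀ i, Function.Surjective (q i)) {Q M : RightMod R} (p : Q ⟶ M) (hQ : Filt G Q)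
    (hp : HasLiftingAgainst (fun i => LinearMap.ker (q i)) p.hom) :
    IsPrecover (Filt G) p ∧ IsSpecialPrecover (Filt G) p := by
  have hpre : IsPrecover (Filt G) p := by
    refine ⟨hQ, fun X hX f => ?_⟩
    obtain ⟨κ, F, hF⟩ := hX
    obtain ⟨k, -, hk⟩ := hF.exists_lift q hq hp (LinearMap.id : X →ₗ[Rᵐᵒᵖ] X)
      Function.surjective_id 0 f.hom (fun y => by
        have : (y : X) = 0 := y.2
        rw [this, map_zero, LinearMap.zero_apply, map_zero])
    refine ⟨ModuleCat.ofHom k, ?_⟩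
    ext x
    exact hk x
  refine ⟨hpre, hQ, le_antisymm ?_ ?_, fun X hX => ?_⟩
  · exact le_iSup_of_le Q (le_iSup_of_le hQ (le_iSup_of_le p le_rfl))
  · refine iSup_le fun X => iSup_le fun hX => iSup_le fun f => ?_
    obtain ⟨h, rfl⟩ := hpre.2 X hX f
    rintro _ ⟨x, rfl⟩
    exact ⟨h.hom x, rfl⟩
  · obtain ⟨κ, F, hF⟩ := hX
    refine subsingleton_ext_of_exists_lift p _
      (Finsupp.linearCombination_id_surjective Rᵐᵒᵖ X) fun h hh => ?_
    exact hF.exists_lift q hq hp _ (Finsupp.linearCombination_id_surjective Rᵐᵒᵖ X) h 0 hh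

theorem exists_special_precover {ι : Type u} (G : ι → RightMod R) (M : RightMod R) :
    ∃ (Q : RightMod R) (p : Q ⟶ M), IsPrecover (Filt G) p ∧ IsSpecialPrecover (Filt G) p := by
  classical
  rcases isEmpty_or_nonempty ι with hι | hι
  · exact ⟨ModuleCat.of Rᵐᵒᵖ PUnit, 0, isSpecialPrecover_of_hasLiftingAgainst (L := PUnit)
      (fun i => isEmptyElim i) (fun i => isEmptyElim i) 0 (filt_of_subsingleton G _)
      (fun i => isEmptyElim i)⟩
  -- The free module on the product set of all `G i` maps onto every `G i`.
  · let q : ∀ i, ((∀ i, G i) →₀ Rᵐᵒᵖ) →ₗ[Rᵐᵒᵖ] G i := fun i =>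
      Finsupp.linearCombination Rᵐᵒᵖ fun x => x i
    have hq : ∀ i, Function.Surjective (q i) := fun i x =>
      ⟨Finsupp.single (Function.update 0 i x) 1, by simp [q]⟩
    obtain ⟨Q, p, hQ, hp⟩ := exists_filt_hasLiftingAgainst G q hq M
    exact ⟨Q, p, isSpecialPrecover_of_hasLiftingAgainst q hq p hQ hp⟩

end RightMod

theorem theoremt (R : Type u) [Ring R] (𝒳 : ObjectProperty (RightMod R))
    (h𝒳 : RightMod.IsDeconstructible 𝒳) :
    RightMod.IsPrecovering 𝒳 ∧ RightMod.IsSpecialPrecovering 𝒳 := by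
  obtain ⟨ι, G, rfl⟩ := h𝒳
  refine ⟨fun M => ?_, fun M => ?_⟩
  · obtain ⟨Q, p, h, -⟩ := RightMod.exists_special_precover G M
    exact ⟨Q, p, h⟩
  · obtain ⟨Q, p, -, h⟩ := RightMod.exists_special_precover G M
    exact ⟨Q, p, h⟩
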